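/- Let $K,D\ge 1$ be integers, let $\mathcal Y\subset\mathbb R^D$ be a measurable set of finite Lebesgue measure, let $\mathcal L$ be the Lebesgue measure on $\mathcal Y$, and let $\|\cdot\|_2$ and $\langle\cdot,\cdot\rangle$ be the norm and inner product of the real space $L^2(\mathcal Y,\mathcal L)$ (and $\|\cdot\|_2$ also the norm of $L^2(\mathcal Y^3,\mathcal L^{\otimes 3})$). For a $K\times K$ transition matrix $Q$ with stationary distribution $\pi$ and $\mathbf f=(f_1,\dots,f_K)\in L^2(\mathcal Y,\mathcal L)^K$ put $$g^{Q,\mathbf f}(y_1,y_2,y_3)=\sum_{k_1,k_2,k_3=1}^K \pi(k_1)Q(k_1,k_2)Q(k_2,k_3)f_{k_1}(y_1)f_{k_2}(y_2)f_{k_3}(y_3).$$ Let $T_Q$ be the set of permutations $\tau$ of $\{1,\dots,K\}$ such that $Q(\tau(i),\tau(j))=Q(i,j)$ for all $i,j$. Let $G(\mathbf f)$ be the Gram matrix $(\langle f_i,f_j\rangle)_{i,j}$ and $A_Q$ the diagonal matrix with diagonal $\pi$. For a $K\times K$ real matrix $U$ with $U\mathbf 1_K=0$ and $G=G(\mathbf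 f)$ let $$\begin{aligned}\mathcal D(U)=\sum_{i,j=1}^K\Big\{&(Q^TA_QUGU^TA_QQ)_{i,j}G_{i,j}(QGQ^T)_{i,j}+(Q^TA_QGA_QQ)_{i,j}(UGU^T)_{i,j}(QGQ^T)_{i,j}\\&+(Q^TA_QGA_QQ)_{i,j}G_{i,j}(QUGU^TQ^T)_{i,j}\Big\}\\+2\sum_{i,j=1}^K\Big\{&(Q^TA_QUGA_QQ)_{i,j}(UG)_{j,i}(QGQ^T)_{i,j}+(Q^TA_QUGA_QQ)_{i,j}(QUGQ^T)_{j,i}G_{i,j}\\&+(UG)_{i,j}(QUGQ^T)_{j,i}(Q^TA_QGA_QQ)_{i,j}\Big\},\end{aligned}$$ a quadratic form in the coefficients $U_{i,j}$, $1\le i\le K$, $1\le j\le K-1$. Its determinant is a rational function of the entries of $Q$ and $G$, with denominator $S^{2K(K-1)}$, where $S$ is the trace of the adjugate of $I-Q$, which is positive for irreducible $Q$; let $H(Q,G)$ be its numerator, that is, the determinant times $S^{2K(K-1)}$. Let $Q^\star$ be a $K\times K$ transition matrix and $\pi^\star$ a probability vector such that: [H1] $Q^\star$ has full rank; [H2]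 the Markov chain with transition matrix $Q^\star$ is irreducible and aperiodic; [H3] its initial distribution $\pi^\star$ is stationary. Let $\mathbf f^\star=(f_1^\star,\dots,f_K^\star)$ be probability densities on $\mathcal Y$ which belong to $L^2(\mathcal Y,\mathcal L)$ and such that: [H4] $f_1^\star,\dots,f_K^\star$ are linearly independent. Assume moreover [HD]: $H(Q^\star,G(\mathbf f^\star))\neq0$. For $\mathbf h\in L^2(\mathcal Y,\mathcal L)^K$ let $\|\mathbf h\|_{Q^\star}^2=\min_{\tau\in T_{Q^\star}}\sum_{k=1}^K\|h_k+f_k^\star-f^\star_{\tau(k)}\|_2^2$. Let $\mathcal K$ be a closed bounded subset of $L^2(\mathcal Y,\mathcal L)^K$ such that $\int h_i\,d\mathcal L=0$ for all $\mathbf h\in\mathcal K$ and $i=1,\dots,K$. Let $\mathcal V$ be a compact neighbourhood of $Q^\star$ in the set of transition matrices such that, for all $Q\in\mathcal V$, $H(Q,G(\mathbf f^\star))\ne0$, [H1]–[H3] hold for $Q$ (with its stationary distribution as initial distribution) and $T_Q\subset T_{Q^\star}$. Then there is a constant $c=c(\mathcal K,\mathcal V,\mathbf f^\star)>0$ such that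 $$\|g^{Q,\mathbf f^\star+\mathbf h}-g^{Q,\mathbf f^\star}\|_2\ \ge\ c\,\|\mathbf h\|_{Q^\star}\qquad\text{for all }\mathbf h\in\mathcal K\text{ and all }Q\in\mathcal V.$$ -/

import Mathlib

open MeasureTheory Topology
open scoped Matrix ENNReal

namespace HMM

noncomputable section

/-! ### Finite Markov chains -/

/-- The set of `K × K` transition matrices (real, nonnegative entries, rows summing to one). -/
def transitionMatrices (K : ℕ) : Set (Matrix (Fin K) (Fin K) ℝ) :=
  {Q | Q ∈ Matrix.rowStochastic ℝ (Fin K)}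

/-- `π` is a probability vector which is stationary for `Q`, that is `π Q = π`. -/
def IsStationaryDist {K : ℕ} (Q : Matrix (Fin K) (Fin K) ℝ) (π : Fin K → ℝ) : Prop :=
  π ∈ stdSimplex ℝ (Fin K) ∧ π ᵥ* Q = π

open Classical in
/-- The stationary distribution of `Q` (it is unique when `Q` is irreducible; the value is `0`
when there is no stationary distribution, which does not happen for a transition matrix). -/
def stationaryDist {K : ℕ} (Q : Matrix (Fin K) (Fin K) ℝ) : Fin K → ℝ :=
  if h : ∃ π : Fin K → ℝ, IsStationaryDist Q π then h.choose else 0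

/-- Every state has period one: `1` is the only common divisor of the possible return times. -/
def IsAperiodic {K : ℕ} (Q : Matrix (Fin K) (Fin K) ℝ) : Prop :=
  ∀ i : Fin K, ∀ d : ℕ, (∀ n : ℕ, 0 < n → 0 < (Q ^ n) i i → d ∣ n) → d = 1

/-- The assumptions on the hidden chain with transition matrix `Q` and initial distribution `π`:
`Q` has full rank, the chain is irreducible and aperiodic, and `π` is stationary. -/
structure ChainAssumptions {K : ℕ} (Q : Matrix (Fin K) (Fin K) ℝ) (π : Fin K → ℝ) : Prop where
  transition : Q ∈ transitionMatrices K
  full_rank : Q.rank = K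
  irreducible : Q.IsIrreducible
  aperiodic : IsAperiodic Q
  stationary : IsStationaryDist Q π

/-- The permutations `τ` of the states such that `Q (τ i) (τ j) = Q i j` for all `i`, `j`. -/
def symmPerms {K : ℕ} (Q : Matrix (Fin K) (Fin K) ℝ) : Set (Equiv.Perm (Fin K)) :=
  {τ | ∀ i j, Q (τ i) (τ j) = Q i j}

/-! ### Laws of three consecutive observations -/

/-- The real Hilbert space of square integrable functions on `Y ⊆ ℝ^D`, for Lebesgue measure. -/
abbrev L2 {D : ℕ} (Y : Set (EuclideanSpace ℝ (Fin D))) : Type :=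
  Lp ℝ 2 (volume.restrict Y)

/-- The function
`(y₁, y₂, y₃) ↦ ∑ π(k₁) Q(k₁, k₂) Q(k₂, k₃) f_{k₁}(y₁) f_{k₂}(y₂) f_{k₃}(y₃)`,
where `π` is the stationary distribution of `Q`. -/
def tripleFun {K : ℕ} {E : Type*} (Q : Matrix (Fin K) (Fin K) ℝ) (f : Fin K → E → ℝ) :
    E × E × E → ℝ :=
  fun y => ∑ k₁, ∑ k₂, ∑ k₃, stationaryDist Q k₁ * Q k₁ k₂ * Q k₂ k₃ *
    (f k₁ y.1 * f k₂ y.2.1 * f k₃ y.2.2)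

/-- The function `tripleFun` for (representatives of) a family of elements of `L²(Y)`. -/
def g {K D : ℕ} {Y : Set (EuclideanSpace ℝ (Fin D))} (Q : Matrix (Fin K) (Fin K) ℝ)
    (f : Fin K → L2 Y) :
    EuclideanSpace ℝ (Fin D) × EuclideanSpace ℝ (Fin D) × EuclideanSpace ℝ (Fin D) → ℝ :=
  tripleFun Q (fun k => (f k : EuclideanSpace ℝ (Fin D) → ℝ))

/-- The `L²` norm of a function on `Y × Y × Y` for Lebesgue measure. -/
def norm3 {D : ℕ} (Y : Set (EuclideanSpace ℝ (Fin D)))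
    (u : EuclideanSpace ℝ (Fin D) × EuclideanSpace ℝ (Fin D) × EuclideanSpace ℝ (Fin D) → ℝ) :
    ℝ :=
  (eLpNorm u 2 ((volume.restrict Y).prod
    ((volume.restrict Y).prod (volume.restrict Y)))).toReal

/-- `‖h‖_Q`, the square root of
`min {∑ₖ ‖hₖ + fₖ - f_{τ(k)}‖² : τ a permutation with Q(τ i, τ j) = Q(i, j) for all i, j}`;
the infimum is over a finite nonempty set. -/
def permNorm {K D : ℕ} {Y : Set (EuclideanSpace ℝ (Fin D))} (Q : Matrix (Fin K) (Fin K) ℝ)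
    (f h : Fin K → L2 Y) : ℝ :=
  Real.sqrt (⨅ τ : symmPerms Q, ∑ k, ‖h k + f k - f (τ.1 k)‖ ^ 2)

/-! ### The quadratic form and its determinant -/

/-- The quadratic form `U ↦ 𝒟(U)`, with `G` a Gram matrix and `A` the diagonal matrix of the
stationary distribution of `Q`. -/
def quadD {K : ℕ} (Q G U : Matrix (Fin K) (Fin K) ℝ) : ℝ :=
  let A : Matrix (Fin K) (Fin K) ℝ := Matrix.diagonal (stationaryDist Q)
  (∑ i, ∑ j,
    ((Qᵀ * A * U * G * Uᵀ * A * Q) i j * G i j * (Q * G * Qᵀ) i j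
      + (Qᵀ * A * G * A * Q) i j * (U * G * Uᵀ) i j * (Q * G * Qᵀ) i j
      + (Qᵀ * A * G * A * Q) i j * G i j * (Q * U * G * Uᵀ * Qᵀ) i j))
  + 2 * ∑ i, ∑ j,
    ((Qᵀ * A * U * G * A * Q) i j * (U * G) j i * (Q * G * Qᵀ) i j
      + (Qᵀ * A * U * G * A * Q) i j * (Q * U * G * Qᵀ) j i * G i j
      + (U * G) i j * (Q * U * G * Qᵀ) j i * (Qᵀ * A * G * A * Q) i j)

/-- The index set `{(i, j) : 1 ≤ i ≤ K, 1 ≤ j ≤ K - 1}` of the free coefficients of a matrix `U`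
with zero row sums. -/
abbrev FreeIndex (K : ℕ) : Type := Fin K × {j : Fin K // j.val + 1 < K}

/-- The matrix `U` with zero row sums whose free coefficient at `a` is one and whose other free
coefficients are zero. -/
def basisU {K : ℕ} (a : FreeIndex K) : Matrix (Fin K) (Fin K) ℝ :=
  Matrix.of fun i j =>
    if i = a.1 then (if j = a.2.1 then 1 else if j.val + 1 = K then -1 else 0) else 0

/-- The determinant of the quadratic form `𝒟` in the free coefficients of `U`, that is, of the
symmetric matrix that represents it. -/
def detD {K : ℕ} (Q G : Matrix (Fin K) (Fin K) ℝ) : ℝ :=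
  Matrix.det (Matrix.of fun a b : FreeIndex K =>
    (quadD Q G (basisU a + basisU b) - quadD Q G (basisU a) - quadD Q G (basisU b)) / 2)

/-- `H(Q, G)`, the numerator of the determinant of `𝒟`. For an irreducible transition matrix `Q`
the stationary distribution is `πₖ = Cₖ / S`, where `Cₖ` is the `k`-th principal cofactor of
`1 - Q` and `S = ∑ₖ Cₖ > 0` is the trace of the adjugate. Each coefficient of `𝒟` is homogeneous
of degree two in `π`, so the determinant, of size `K (K - 1)`, is a polynomial in the entries of
`Q` and `G` divided by `S ^ (2 K (K - 1))`; the value below is that polynomial. -/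
def H {K : ℕ} (Q G : Matrix (Fin K) (Fin K) ℝ) : ℝ :=
  detD Q G * (Matrix.trace (1 - Q).adjugate) ^ (2 * (K * (K - 1)))

end

end HMM

/-! ### Exact identifiability from matrix slices. -/

namespace HMM

noncomputable section

variable {K : ℕ}

/-! Write `f = fstar`, `F = fstar + h`, and let `ε` be the L² distance of the two third order
tensors. Paired with `u ⊗ v ⊗ w`, they differ by at most `ε ‖u‖ ‖v‖ ‖w‖` (`abs_tripleDiff_le`).
Choose a dual family `d` of `f` whose sum is the constant function 1, and put `U k i = ⟪F k, d i⟫`,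
`P = diag(π) Q`. Pairing with `d i`, `w`, `d l` gives the entries of `Uᵀ P diag⟪F k, w⟫ Q U` and `P
diag⟪f k, w⟫ Q`; for `w = 1` both diagonals are the identity. Simultaneous diagonalization
(`intertwine`) then shows that `W = Q (Q U)⁻¹` satisfies `W r s * ⟪F s - f r, w⟫ = O(ε ‖w‖)`, as
long as the inverses of `P` and `Q U` stay bounded. The choice `w = F s - f r` gives a bound linear
in `ε` wherever `W r s ≥ 1/2` (`norm_sub_le_of_tripleDiff_le`), and this also controls the part of
`F` outside the span of `f`.

Such entries come from compactness of the finite-dimensional set of triples `(Q, π, U)`. Near a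
triple whose coefficient tensors differ, `ε` is bounded below and boundedness of the families
suffices. At a triple where they agree, `exists_symmPerm_of_slices_eq` gives a symmetry `τ` of `Q`
with `W (τ s) s = 1`, and these entries stay above `1/2` nearby. A finite cover makes the constant
uniform; the set of perturbations only has to be bounded. -/

/-- The trilinear form whose coefficients are the probabilities `π k₁ Q k₁ k₂ Q k₂ k₃`. -/
def tripleForm (Q : Matrix (Fin K) (Fin K) ℝ) (π x y z : Fin K → ℝ) : ℝ :=
  ∑ k₁, ∑ k₂, ∑ k₃, π k₁ * Q k₁ k₂ * Q k₂ k₃ * (x k₁ * y k₂ * z k₃)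

theorem slice_apply_eq_tripleForm (Q U : Matrix (Fin K) (Fin K) ℝ) (π y : Fin K → ℝ)
    (i l : Fin K) :
    (Uᵀ * (Matrix.diagonal π * Q) * Matrix.diagonal y * (Q * U)) i l =
      tripleForm Q π (fun k => U k i) y (fun k => U k l) := by
  rw [Matrix.mul_apply]
  simp only [Matrix.mul_diagonal]
  simp only [Matrix.mul_apply (M := Uᵀ), Matrix.mul_apply (M := Q), Matrix.diagonal_mul,
    Matrix.transpose_apply, tripleForm]
  rw [Finset.sum_comm]
  refine Finset.sum_congr rfl fun k₂ _ => ?_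
  rw [Finset.sum_mul, Finset.sum_mul_sum]
  refine Finset.sum_congr rfl fun k₁ _ => Finset.sum_congr rfl fun k₃ _ => ?_
  ring

theorem slice_apply_eq_tripleForm_one (Q : Matrix (Fin K) (Fin K) ℝ) (π y : Fin K → ℝ)
    (i l : Fin K) :
    (Matrix.diagonal π * Q * Matrix.diagonal y * Q) i l =
      tripleForm Q π (fun k => (1 : Matrix (Fin K) (Fin K) ℝ) k i) y
        (fun k => (1 : Matrix (Fin K) (Fin K) ℝ) k l) := by
  simpa using slice_apply_eq_tripleForm Q 1 π y i l

/-- Two families of matrices which are simultaneously diagonalized, and whose slices `L D b` and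
`P E Q` are close, have change of basis matrices that nearly intertwine the diagonals. -/
theorem intertwine {P L Q b : Matrix (Fin K) (Fin K) ℝ} (hP : P.det ≠ 0) (hb : b.det ≠ 0)
    (x y : Fin K → ℝ) (r s : Fin K) :
    (Q * b⁻¹) r s * (x s - y r) =
      (P⁻¹ * (L * Matrix.diagonal x * b - P * Matrix.diagonal y * Q) * b⁻¹) r s
        - (P⁻¹ * (L * b - P * Q) * b⁻¹) r s * x s := by
  have hP' : P⁻¹ * P = 1 := Matrix.nonsing_inv_mul _ (isUnit_iff_ne_zero.2 hP)
  have hb' : b * b⁻¹ = 1 := Matrix.mul_nonsing_inv _ (isUnit_iff_ne_zero.2 hb)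
  have h1 : P⁻¹ * (L * Matrix.diagonal x * b - P * Matrix.diagonal y * Q) * b⁻¹ =
      P⁻¹ * L * Matrix.diagonal x - Matrix.diagonal y * (Q * b⁻¹) := by
    calc _ = P⁻¹ * L * Matrix.diagonal x * (b * b⁻¹)
          - (P⁻¹ * P) * Matrix.diagonal y * (Q * b⁻¹) := by noncomm_ring
      _ = _ := by rw [hP', hb', mul_one, one_mul]
  have h2 : P⁻¹ * (L * b - P * Q) * b⁻¹ = P⁻¹ * L - Q * b⁻¹ := by
    calc _ = P⁻¹ * L * (b * b⁻¹) - (P⁻¹ * P) * (Q * b⁻¹) := by noncomm_ring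
      _ = _ := by rw [hP', hb', mul_one, one_mul]
  -- Subtracting `h2` times `diagonal x` from `h1` cancels the term `P⁻¹ * L * diagonal x`.
  rw [h1, h2, Matrix.sub_apply, Matrix.sub_apply, Matrix.mul_diagonal, Matrix.diagonal_mul]
  ring

theorem sum_diagonal_col {U : Matrix (Fin K) (Fin K) ℝ} (hU : ∀ i, ∑ j, U i j = 1) :
    ∑ j, Matrix.diagonal (fun k => U k j) = (1 : Matrix (Fin K) (Fin K) ℝ) := by
  ext a b
  rw [Matrix.sum_apply]
  by_cases h : a = b
  · subst h; simp [hU]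
  · simp [h]

/-- Identifiability: a family with coefficient matrix `U` that has the same third order tensor as
the identity is a permutation of the basis, by a symmetry of `Q`. -/
theorem exists_symmPerm_of_slices_eq {Q U : Matrix (Fin K) (Fin K) ℝ} {π : Fin K → ℝ}
    (hQ : Q.det ≠ 0) (hπ : ∀ i, π i ≠ 0) (hQ1 : ∀ i, ∑ j, Q i j = 1)
    (hU1 : ∀ i, ∑ j, U i j = 1)
    (h : ∀ j, Uᵀ * (Matrix.diagonal π * Q) * Matrix.diagonal (fun k => U k j) * (Q * U) =
      Matrix.diagonal π * Q * Matrix.diagonal (fun k => (1 : Matrix (Fin K) (Fin K) ℝ) k j) * Q) :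
    U.det ≠ 0 ∧ ∃ τ ∈ symmPerms Q, ∀ s, (Q * (Q * U)⁻¹) (τ s) s = 1 := by
  set P := Matrix.diagonal π * Q with hPdef
  have hP : P.det ≠ 0 := by
    rw [hPdef, Matrix.det_mul, Matrix.det_diagonal]
    exact mul_ne_zero (Finset.prod_ne_zero_iff.2 fun i _ => hπ i) hQ
  -- Since the rows of `U` sum to one, adding the slices over `j` removes the middle diagonal
  -- factor; determinants then give invertibility of `U`.
  have hsum : Uᵀ * P * (Q * U) = P * Q := by
    have := Finset.sum_congr rfl fun j (_ : j ∈ Finset.univ) => h j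
    rwa [← Finset.sum_mul, ← Finset.sum_mul, ← Finset.mul_sum, ← Finset.mul_sum,
      sum_diagonal_col hU1, sum_diagonal_col (U := 1) (by simp [Matrix.one_apply]), mul_one,
      mul_one] at this
  have hUdet : U.det ≠ 0 := by
    intro h0
    have := congrArg Matrix.det hsum
    rw [Matrix.det_mul, Matrix.det_mul, Matrix.det_transpose, h0, zero_mul, zero_mul] at this
    exact mul_ne_zero hP hQ (by rw [← Matrix.det_mul]; exact this.symm)
  have hb : (Q * U).det ≠ 0 := by rw [Matrix.det_mul]; exact mul_ne_zero hQ hUdet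
  refine ⟨hUdet, ?_⟩
  set W := Q * (Q * U)⁻¹ with hW
  have hWb : W * (Q * U) = Q := by
    rw [hW, mul_assoc, Matrix.nonsing_inv_mul _ (isUnit_iff_ne_zero.2 hb), mul_one]
  have hWdet : W.det ≠ 0 := by
    intro h0
    have := congrArg Matrix.det hWb
    rw [Matrix.det_mul, h0, zero_mul] at this
    exact hQ this.symm
  have key : ∀ r s j, W r s * (U s j - (1 : Matrix (Fin K) (Fin K) ℝ) r j) = 0 := by
    intro r s j
    rw [hW, intertwine hP hb (L := Uᵀ * P) (fun k => U k j)
      (fun k => (1 : Matrix (Fin K) (Fin K) ℝ) k j), h j, hsum]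
    simp
  have hex : ∀ s, ∃ r, W r s ≠ 0 := by
    intro s
    by_contra! hs
    exact hWdet (Matrix.det_eq_zero_of_column_eq_zero s hs)
  choose σ hσ using hex
  -- A nonzero entry of `W` in column `s` and row `σ s` forces row `s` of `U` to be a row of the
  -- identity.
  have hUσ : ∀ s j, U s j = (1 : Matrix (Fin K) (Fin K) ℝ) (σ s) j := fun s j =>
    sub_eq_zero.1 ((mul_eq_zero.1 (key (σ s) s j)).resolve_left (hσ s))
  have hσinj : Function.Injective σ := by
    intro s t hst
    by_contra hne
    exact hUdet (Matrix.det_zero_of_row_eq hne (funext fun j => by rw [hUσ, hUσ, hst]))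
  let τ : Equiv.Perm (Fin K) := Equiv.ofBijective σ (Finite.injective_iff_bijective.1 hσinj)
  have hτ : ∀ s, τ s = σ s := fun s => rfl
  -- The choice `j = r` in `key` makes the second factor equal to `-1`.
  have hW0 : ∀ r s, r ≠ σ s → W r s = 0 := by
    intro r s hrs
    refine (mul_eq_zero.1 (key r s r)).resolve_right ?_
    rw [hUσ, Matrix.one_apply_ne hrs.symm, Matrix.one_apply_eq]
    norm_num
  have hrow : ∀ s (v : Fin K → ℝ), ∑ t, W (σ s) t * v t = W (σ s) s * v s := by
    intro s v
    refine Finset.sum_eq_single s (fun t _ hts => ?_) (by simp)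
    rw [hW0 _ _ (fun he => hts (hσinj he).symm), zero_mul]
  have hb1 : ∀ s, ∑ j, (Q * U) s j = 1 := by
    intro s
    simp only [Matrix.mul_apply]
    rw [Finset.sum_comm]
    simp [← Finset.mul_sum, hU1, hQ1]
  -- Both `Q` and `Q * U` have row sums one, so `W` has as well, and only one entry of row `σ s`
  -- survives.
  have hW1 : ∀ s, W (σ s) s = 1 := by
    intro s
    have h1 : ∑ j, (W * (Q * U)) (σ s) j = 1 := by rw [hWb]; exact hQ1 _
    have h2 : ∑ j, (W * (Q * U)) (σ s) j = ∑ t, W (σ s) t * 1 := by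
      simp only [Matrix.mul_apply (M := W)]
      rw [Finset.sum_comm]
      simp [← Finset.mul_sum, hb1]
    rw [h2, hrow] at h1
    simpa using h1
  refine ⟨τ, fun s j => ?_, hW1⟩
  have h1 : (W * (Q * U)) (σ s) (σ j) = Q (σ s) (σ j) := by rw [hWb]
  rw [Matrix.mul_apply, hrow s fun t => (Q * U) t (σ j), hW1, one_mul, Matrix.mul_apply] at h1
  rw [hτ, hτ, ← h1]
  simp only [hUσ]
  simp [Matrix.one_apply, hσinj.eq_iff]

/-- Some state has positive mass; irreducibility carries it to any `j` along a power of `Q`, and `π`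
is invariant under that power. -/
theorem IsStationaryDist.pos {Q : Matrix (Fin K) (Fin K) ℝ} {π : Fin K → ℝ}
    (hπ : IsStationaryDist Q π) (hQ : Q.IsIrreducible) (j : Fin K) : 0 < π j := by
  obtain ⟨⟨h0, h1⟩, hst⟩ := hπ
  obtain ⟨i, hi⟩ : ∃ i, 0 < π i := by
    by_contra! h
    have : ∑ i, π i ≤ 0 := Finset.sum_nonpos fun i _ => h i
    linarith
  obtain ⟨n, -, hn⟩ := (Matrix.isIrreducible_iff_exists_pow_pos hQ.nonneg).1 hQ i j
  have hpow : ∀ n : ℕ, π ᵥ* Q ^ n = π := by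
    intro n
    induction n with
    | zero => simp
    | succ n ih => rw [pow_succ, ← Matrix.vecMul_vecMul, ih, hst]
  have hj : π j = ∑ m, π m * (Q ^ n) m j := (congrFun (hpow n) j).symm
  rw [hj]
  refine Finset.sum_pos' (fun m _ => mul_nonneg (h0 m)
    (Matrix.pow_apply_nonneg hQ.nonneg n m j)) ⟨i, Finset.mem_univ _, mul_pos hi hn⟩

theorem ChainAssumptions.det_ne_zero {Q : Matrix (Fin K) (Fin K) ℝ} {π : Fin K → ℝ}
    (h : ChainAssumptions Q π) : Q.det ≠ 0 := by
  have hr : LinearIndependent ℝ Q.col := by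
    rw [linearIndependent_iff_card_eq_finrank_span, Set.finrank, ← Matrix.rank_eq_finrank_span_cols]
    simp [h.full_rank]
  exact ((Matrix.isUnit_iff_isUnit_det _).1
    (Matrix.linearIndependent_cols_iff_isUnit.1 hr)).ne_zero

end

end HMM

/-! ### Stability of the tensors in a real inner product space. -/

namespace HMM

noncomputable section

variable {K : ℕ} {E : Type*} [NormedAddCommGroup E] [InnerProductSpace ℝ E]

/-- A linearly independent family on which `⟪·, e⟫ = 1` has a dual family with sum `e`. -/
theorem exists_dual_family_sum_eq (hK : 0 < K) {f : Fin K → E} (hf : LinearIndependent ℝ f)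
    {e : E} (he : ∀ k, inner ℝ (f k) e = 1) :
    ∃ d : Fin K → E, (∀ i j, inner ℝ (f i) (d j) = (1 : Matrix (Fin K) (Fin K) ℝ) i j) ∧
      ∑ j, d j = e := by
  set G := Matrix.gram ℝ f with hG
  have hdet : IsUnit G.det := (Matrix.posDef_gram_of_linearIndependent hf).det_pos.ne'.isUnit
  let d₀ : Fin K → E := fun j => ∑ m, G⁻¹ m j • f m
  have hd₀ : ∀ i j, inner ℝ (f i) (d₀ j) = (1 : Matrix (Fin K) (Fin K) ℝ) i j := by
    intro i j
    rw [← Matrix.mul_nonsing_inv G hdet, Matrix.mul_apply]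
    simp only [d₀, inner_sum, inner_smul_right, hG, Matrix.gram_apply]
    exact Finset.sum_congr rfl fun m _ => mul_comm _ _
  have hK' : (K : ℝ) ≠ 0 := by exact_mod_cast hK.ne'
  -- The vector `e - ∑ m, d₀ m` is orthogonal to every `f i`, so sharing it equally among the `d₀ j`
  -- keeps duality and corrects the sum to `e`.
  refine ⟨fun j => d₀ j + (K : ℝ)⁻¹ • (e - ∑ m, d₀ m), fun i j => ?_, ?_⟩
  · rw [inner_add_right, hd₀, inner_smul_right, inner_sub_right, he, inner_sum]
    simp [hd₀, Matrix.one_apply]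
  · rw [Finset.sum_add_distrib, Finset.sum_const, Finset.card_univ, Fintype.card_fin,
      ← Nat.cast_smul_eq_nsmul ℝ, smul_smul, mul_inv_cancel₀ hK', one_smul]
    abel

/-- The values on pure tensors of the difference of the third order tensors of two families. -/
def tripleDiff (Q : Matrix (Fin K) (Fin K) ℝ) (π : Fin K → ℝ) (f F : Fin K → E) (u v w : E) : ℝ :=
  tripleForm Q π (fun k => inner ℝ (F k) u) (fun k => inner ℝ (F k) v) (fun k => inner ℝ (F k) w)
    - tripleForm Q π (fun k => inner ℝ (f k) u) (fun k => inner ℝ (f k) v)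
      (fun k => inner ℝ (f k) w)

theorem slice_sub_apply_eq_tripleDiff {f d F : Fin K → E} {U : Matrix (Fin K) (Fin K) ℝ}
    (hd : ∀ i j, inner ℝ (f i) (d j) = (1 : Matrix (Fin K) (Fin K) ℝ) i j)
    (hU : ∀ k i, inner ℝ (F k) (d i) = U k i) (Q : Matrix (Fin K) (Fin K) ℝ) (π : Fin K → ℝ)
    (w : E) (i l : Fin K) :
    (Uᵀ * (Matrix.diagonal π * Q) * Matrix.diagonal (fun k => inner ℝ (F k) w) * (Q * U)
      - Matrix.diagonal π * Q * Matrix.diagonal (fun k => inner ℝ (f k) w) * Q) i l =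
      tripleDiff Q π f F (d i) w (d l) := by
  rw [Matrix.sub_apply, slice_apply_eq_tripleForm, slice_apply_eq_tripleForm_one, tripleDiff]
  simp only [hd, hU]

theorem abs_mul_apply_le {A B : Matrix (Fin K) (Fin K) ℝ} {a b : ℝ} (hA : ∀ i j, |A i j| ≤ a)
    (hB : ∀ i j, |B i j| ≤ b) (i j : Fin K) : |(A * B) i j| ≤ K * (a * b) := by
  rw [Matrix.mul_apply]
  calc |∑ k, A i k * B k j| ≤ ∑ k, |A i k * B k j| := Finset.abs_sum_le_sum_abs _ _
    _ ≤ ∑ _k : Fin K, a * b := Finset.sum_le_sum fun k _ => by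
        rw [abs_mul]
        exact mul_le_mul (hA i k) (hB k j) (abs_nonneg _) ((abs_nonneg _).trans (hA i k))
    _ = K * (a * b) := by simp

theorem _root_.ContinuousAt.exists_eventually_abs_apply_le {X : Type*} [TopologicalSpace X] {x : X}
    {A : X → Matrix (Fin K) (Fin K) ℝ} (hA : ContinuousAt A x) :
    ∃ C : ℝ, 0 ≤ C ∧ ∀ᶠ p in 𝓝 x, ∀ i j, |A p i j| ≤ C := by
  refine ⟨∑ i, ∑ j, |A x i j| + 1, by positivity, ?_⟩
  rw [Filter.eventually_all]; intro i
  rw [Filter.eventually_all]; intro j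
  have hc : ContinuousAt (fun p => |A p i j|) x :=
    ((continuous_id.matrix_elem i j).continuousAt.comp hA).abs
  have hlt : |A x i j| < ∑ i, ∑ j, |A x i j| + 1 := by
    have h1 : |A x i j| ≤ ∑ j, |A x i j| :=
      Finset.single_le_sum (f := fun j => |A x i j|) (fun _ _ => abs_nonneg _) (Finset.mem_univ j)
    have h2 : ∑ j, |A x i j| ≤ ∑ i, ∑ j, |A x i j| :=
      Finset.single_le_sum (f := fun i => ∑ j, |A x i j|)
        (fun _ _ => Finset.sum_nonneg fun _ _ => abs_nonneg _) (Finset.mem_univ i)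
    linarith
  exact (hc.eventually_lt_const hlt).mono fun _ h => h.le

theorem _root_.ContinuousAt.matrix_inv_of_det_ne_zero {X : Type*} [TopologicalSpace X] {x : X}
    {A : X → Matrix (Fin K) (Fin K) ℝ} (hA : ContinuousAt A x) (h : (A x).det ≠ 0) :
    ContinuousAt (fun p => (A p)⁻¹) x := by
  refine ContinuousAt.comp (g := Inv.inv) (continuousAt_matrix_inv _ ?_) hA
  rw [Ring.inverse_eq_inv']
  exact continuousAt_inv₀ h

theorem continuous_tripleForm {X : Type*} [TopologicalSpace X]
    {Q : X → Matrix (Fin K) (Fin K) ℝ} {π x y z : X → Fin K → ℝ} (hQ : Continuous Q)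
    (hπ : Continuous π) (hx : Continuous x) (hy : Continuous y) (hz : Continuous z) :
    Continuous fun p => tripleForm (Q p) (π p) (x p) (y p) (z p) := by
  unfold tripleForm
  have h : ∀ i j, Continuous fun p => Q p i j := fun i j => hQ.matrix_elem i j
  fun_prop

/-- The quantitative form of `exists_symmPerm_of_slices_eq`: a bound on the distance between the
two families when the change of basis matrix has a large entry. -/
theorem norm_sub_le_of_tripleDiff_le {f d F : Fin K → E} {e : E}
    {Q U : Matrix (Fin K) (Fin K) ℝ} {π : Fin K → ℝ} {B C m ε : ℝ} {r s : Fin K}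
    (hd : ∀ i j, inner ℝ (f i) (d j) = (1 : Matrix (Fin K) (Fin K) ℝ) i j)
    (hf : ∀ k, inner ℝ (f k) e = 1) (hF : ∀ k, inner ℝ (F k) e = 1)
    (hU : ∀ k i, inner ℝ (F k) (d i) = U k i) (hFB : ‖F s‖ ≤ B) (hdm : ∀ i, ‖d i‖ ≤ m)
    (hP : (Matrix.diagonal π * Q).det ≠ 0) (hb : (Q * U).det ≠ 0)
    (hPC : ∀ i j, |(Matrix.diagonal π * Q)⁻¹ i j| ≤ C) (hbC : ∀ i j, |(Q * U)⁻¹ i j| ≤ C)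
    (hW : 1 / 2 ≤ (Q * (Q * U)⁻¹) r s) (hε : 0 ≤ ε)
    (h : ∀ u v w, |tripleDiff Q π f F u v w| ≤ ε * (‖u‖ * ‖v‖ * ‖w‖)) :
    ‖F s - f r‖ ≤ 2 * (K * (K * (C * (m * m)) * C) * (1 + ‖e‖ * B)) * ε := by
  have hm : 0 ≤ m := (norm_nonneg _).trans (hdm s)
  have hC : 0 ≤ C := (abs_nonneg _).trans (hPC s s)
  have hB : 0 ≤ B := (norm_nonneg _).trans hFB
  set w := F s - f r with hw
  have hN : ∀ v : E, ∀ i l,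
      |(Uᵀ * (Matrix.diagonal π * Q) * Matrix.diagonal (fun k => inner ℝ (F k) v) * (Q * U)
      - Matrix.diagonal π * Q * Matrix.diagonal (fun k => inner ℝ (f k) v) * Q) i l| ≤
      ε * ‖v‖ * (m * m) := by
    intro v i l
    rw [slice_sub_apply_eq_tripleDiff hd hU]
    refine (h _ _ _).trans ?_
    rw [mul_assoc ε]
    refine mul_le_mul_of_nonneg_left ?_ hε
    calc ‖d i‖ * ‖v‖ * ‖d l‖ = ‖v‖ * (‖d i‖ * ‖d l‖) := by ring
      _ ≤ ‖v‖ * (m * m) := by gcongr <;> exact hdm _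
  -- Testing in the middle slot with `e` turns both diagonals into the identity, which is the second
  -- slice that `intertwine` requires.
  have hNe := hN e
  simp only [hF, hf, Matrix.diagonal_one, mul_one] at hNe
  -- The middle test vector is the unknown `w = F s - f r` itself, so the left side becomes `W r s *
  -- ‖w‖ ^ 2`.
  have key := intertwine hP hb (Q := Q) (L := Uᵀ * (Matrix.diagonal π * Q))
    (fun k => inner ℝ (F k) w) (fun k => inner ℝ (f k) w) r s
  have h1 := abs_mul_apply_le (abs_mul_apply_le hPC (hN w)) hbC r s
  have h2 := abs_mul_apply_le (abs_mul_apply_le hPC hNe) hbC r s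
  rw [← inner_sub_left, ← hw, real_inner_self_eq_norm_sq] at key
  have h3 : |inner ℝ (F s) w| ≤ B * ‖w‖ :=
    (abs_real_inner_le_norm _ _).trans (by gcongr)
  set c := (K : ℝ) * (K * (C * (m * m)) * C) with hc
  have h4 : ‖w‖ * ‖w‖ ≤ 2 * (c * (1 + ‖e‖ * B)) * ε * ‖w‖ := by
    have h5 : 1 / 2 * ‖w‖ ^ 2 ≤ (Q * (Q * U)⁻¹) r s * ‖w‖ ^ 2 := by gcongr
    have h6 : ∀ a b x y z : ℝ, |a| ≤ x → |b| ≤ y → |z| ≤ B * ‖w‖ → 0 ≤ y →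
        a - b * z ≤ x + y * (B * ‖w‖) := by
      intro a b x y z ha hb hz hy
      have : |b * z| ≤ y * (B * ‖w‖) := by rw [abs_mul]; gcongr
      linarith [le_abs_self a, neg_abs_le (b * z)]
    have h7 := h6 _ _ _ _ _ h1 h2 h3 (by positivity)
    rw [← key] at h7
    calc ‖w‖ * ‖w‖ = 2 * (1 / 2 * ‖w‖ ^ 2) := by ring
      _ ≤ _ := mul_le_mul_of_nonneg_left (h5.trans h7) zero_le_two
      _ = _ := by rw [hc]; ring
  -- The estimate is quadratic in `‖w‖` on the left and linear on the right; one factor cancels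
  -- unless `w = 0`.
  rcases (norm_nonneg w).eq_or_lt with h0 | h0
  · rw [← h0]
    positivity
  · exact le_of_mul_le_mul_right h4 h0

/-- Local stability: near any admissible parameter, two families are close up to a permutation when
their tensors are. -/
theorem eventually_norm_sub_perm_le {f d : Fin K → E} {e : E}
    (hd : ∀ i j, inner ℝ (f i) (d j) = (1 : Matrix (Fin K) (Fin K) ℝ) i j)
    (hf : ∀ k, inner ℝ (f k) e = 1) {T : Set (Equiv.Perm (Fin K))} (hT : 1 ∈ T)
    {B : ℝ} (hB : 0 ≤ B) {Q₀ U₀ : Matrix (Fin K) (Fin K) ℝ} {π₀ : Fin K → ℝ}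
    (hQ : Q₀.det ≠ 0) (hπ : ∀ i, π₀ i ≠ 0) (hQ1 : ∀ i, ∑ j, Q₀ i j = 1)
    (hU1 : ∀ i, ∑ j, U₀ i j = 1) (hQT : symmPerms Q₀ ⊆ T) :
    ∃ C : ℝ, 0 ≤ C ∧
      ∀ᶠ p : Matrix (Fin K) (Fin K) ℝ × (Fin K → ℝ) × Matrix (Fin K) (Fin K) ℝ in
        𝓝 (Q₀, π₀, U₀), ∀ F : Fin K → E, (∀ k i, inner ℝ (F k) (d i) = p.2.2 k i) →
          (∀ k, inner ℝ (F k) e = 1) → (∀ k, ‖F k‖ ≤ B) → ∀ ε : ℝ, 0 ≤ ε →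
          (∀ u v w, |tripleDiff p.1 p.2.1 f F u v w| ≤ ε * (‖u‖ * ‖v‖ * ‖w‖)) →
          ∃ τ ∈ T, ∀ s, ‖F s - f (τ s)‖ ≤ C * ε := by
  obtain ⟨m, hm0, hm⟩ : ∃ m : ℝ, 0 ≤ m ∧ ∀ i, ‖d i‖ ≤ m :=
    ⟨∑ i, ‖d i‖, by positivity, fun i => Finset.single_le_sum (f := fun i => ‖d i‖)
      (fun _ _ => norm_nonneg _) (Finset.mem_univ i)⟩
  obtain ⟨b, hb0, hb⟩ : ∃ b : ℝ, 0 ≤ b ∧ ∀ i, ‖f i‖ ≤ b :=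
    ⟨∑ i, ‖f i‖, by positivity, fun i => Finset.single_le_sum (f := fun i => ‖f i‖)
      (fun _ _ => norm_nonneg _) (Finset.mem_univ i)⟩
  let δ : Fin K → Fin K → Fin K →
      Matrix (Fin K) (Fin K) ℝ × (Fin K → ℝ) × Matrix (Fin K) (Fin K) ℝ → ℝ := fun i j l p =>
    tripleForm p.1 p.2.1 (fun k => p.2.2 k i) (fun k => p.2.2 k j) (fun k => p.2.2 k l) -
      tripleForm p.1 p.2.1 (fun k => (1 : Matrix (Fin K) (Fin K) ℝ) k i)
        (fun k => (1 : Matrix (Fin K) (Fin K) ℝ) k j) (fun k => (1 : Matrix (Fin K) (Fin K) ℝ) k l)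
  have hcU : ∀ i, Continuous fun p : Matrix (Fin K) (Fin K) ℝ × (Fin K → ℝ) ×
      Matrix (Fin K) (Fin K) ℝ => fun k => p.2.2 k i := fun i =>
    continuous_pi fun k => continuous_snd.snd.matrix_elem k i
  have hδ : ∀ i j l, Continuous (δ i j l) := fun i j l =>
    (continuous_tripleForm continuous_fst continuous_snd.fst (hcU i) (hcU j) (hcU l)).sub
      (continuous_tripleForm continuous_fst continuous_snd.fst continuous_const continuous_const
        continuous_const)
  -- Either the coefficient tensors agree at the base point and identifiability applies, or some
  -- entry differs and `ε` cannot be small nearby.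
  by_cases hzero : ∀ i j l, δ i j l (Q₀, π₀, U₀) = 0
  · obtain ⟨hUdet, τ, hτ, hW⟩ := exists_symmPerm_of_slices_eq hQ hπ hQ1 hU1 fun j => by
      ext i l
      rw [slice_apply_eq_tripleForm, slice_apply_eq_tripleForm_one]
      exact sub_eq_zero.1 (hzero i j l)
    have hPdet : (Matrix.diagonal π₀ * Q₀).det ≠ 0 := by
      rw [Matrix.det_mul, Matrix.det_diagonal]
      exact mul_ne_zero (Finset.prod_ne_zero_iff.2 fun i _ => hπ i) hQ
    have hbdet : (Q₀ * U₀).det ≠ 0 := by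
      rw [Matrix.det_mul]; exact mul_ne_zero hQ hUdet
    have hPc : Continuous fun p : Matrix (Fin K) (Fin K) ℝ × (Fin K → ℝ) ×
        Matrix (Fin K) (Fin K) ℝ => Matrix.diagonal p.2.1 * p.1 :=
      continuous_snd.fst.matrix_diagonal.matrix_mul continuous_fst
    have hbc : Continuous fun p : Matrix (Fin K) (Fin K) ℝ × (Fin K → ℝ) ×
        Matrix (Fin K) (Fin K) ℝ => p.1 * p.2.2 :=
      continuous_fst.matrix_mul continuous_snd.snd
    have hPi := hPc.continuousAt.matrix_inv_of_det_ne_zero (x := (Q₀, π₀, U₀)) hPdet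
    have hbi := hbc.continuousAt.matrix_inv_of_det_ne_zero (x := (Q₀, π₀, U₀)) hbdet
    obtain ⟨C₁, hC₁, hP₁⟩ := hPi.exists_eventually_abs_apply_le
    obtain ⟨C₂, hC₂, hb₂⟩ := hbi.exists_eventually_abs_apply_le
    have hWc : ∀ s, ∀ᶠ p : Matrix (Fin K) (Fin K) ℝ × (Fin K → ℝ) × Matrix (Fin K) (Fin K) ℝ in
        𝓝 (Q₀, π₀, U₀), 1 / 2 < (p.1 * (p.1 * p.2.2)⁻¹) (τ s) s := by
      intro s
      have hc : ContinuousAt (fun p : Matrix (Fin K) (Fin K) ℝ × (Fin K → ℝ) ×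
          Matrix (Fin K) (Fin K) ℝ => p.1 * (p.1 * p.2.2)⁻¹) (Q₀, π₀, U₀) := by
        have h2 : Continuous fun q : Matrix (Fin K) (Fin K) ℝ × Matrix (Fin K) (Fin K) ℝ =>
          q.1 * q.2 := continuous_fst.matrix_mul continuous_snd
        exact h2.continuousAt.comp (continuousAt_fst.prodMk hbi)
      have hc' := (continuous_id.matrix_elem (τ s) s).continuousAt.comp hc
      refine hc'.eventually_const_lt ?_
      change 1 / 2 < (Q₀ * (Q₀ * U₀)⁻¹) (τ s) s
      rw [hW]
      norm_num
    refine ⟨2 * (K * (K * (max C₁ C₂ * (m * m)) * max C₁ C₂) * (1 + ‖e‖ * B)),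
      by positivity, ?_⟩
    filter_upwards [hP₁, hb₂, Filter.eventually_all.2 hWc,
      hPc.matrix_det.continuousAt.eventually_ne hPdet,
      hbc.matrix_det.continuousAt.eventually_ne hbdet] with p h1 h2 h3 h4 h5 F hU hF hFB ε hε h
    exact ⟨τ, hQT hτ, fun s => norm_sub_le_of_tripleDiff_le hd hf hF hU (hFB s) hm h4 h5
      (fun i j => (h1 i j).trans (le_max_left _ _)) (fun i j => (h2 i j).trans (le_max_right _ _))
      (h3 s).le hε h⟩
  · push Not at hzero
    obtain ⟨i, j, l, hne⟩ := hzero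
    set η := |δ i j l (Q₀, π₀, U₀)| / 2 with hη
    have hηpos : 0 < η := half_pos (abs_pos.2 hne)
    -- Here `ε * m ^ 3 ≥ η`, so the crude bound `B + b` is already linear in `ε`, and the identity
    -- permutation serves.
    refine ⟨(B + b) * (m * m * m) / η, by positivity, ?_⟩
    have hev := (hδ i j l).abs.continuousAt.eventually_const_lt
      (half_lt_self (abs_pos.2 hne))
    filter_upwards [hev] with p hp F hU hF hFB ε hε h
    refine ⟨1, hT, fun s => ?_⟩
    have h1 : tripleDiff p.1 p.2.1 f F (d i) (d j) (d l) = δ i j l p := by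
      simp only [tripleDiff, hd, hU, δ]
    have h2 : η ≤ ε * (m * m * m) := by
      have := h (d i) (d j) (d l)
      rw [h1] at this
      refine hp.le.trans (this.trans (mul_le_mul_of_nonneg_left ?_ hε))
      gcongr <;> exact hm _
    calc ‖F s - f ((1 : Equiv.Perm (Fin K)) s)‖ ≤ ‖F s‖ + ‖f s‖ := norm_sub_le _ _
      _ ≤ (B + b) * 1 := by rw [mul_one]; exact add_le_add (hFB s) (hb s)
      _ ≤ (B + b) * (ε * (m * m * m) / η) := by
          gcongr; exact (one_le_div hηpos).2 h2
      _ = _ := by ring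

/-- Uniform stability over a compact set of transition matrices and a bounded set of families. No
assumption on the determinant of the quadratic form is needed: its nondegeneracy is implied by the
chain assumptions, the linear independence of `f` and the normalization `⟪f k, e⟫ = 1`. -/
theorem exists_norm_sub_perm_le (hK : 0 < K) {f : Fin K → E} (hf : LinearIndependent ℝ f) {e : E}
    (he : ∀ k, inner ℝ (f k) e = 1) {T : Set (Equiv.Perm (Fin K))} (hT : 1 ∈ T)
    {B : ℝ} (hB : 0 ≤ B) {𝒱 : Set (Matrix (Fin K) (Fin K) ℝ)} (h𝒱 : IsCompact 𝒱)
    (hchain : ∀ Q ∈ 𝒱, ChainAssumptions Q (stationaryDist Q))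
    (hsymm : ∀ Q ∈ 𝒱, symmPerms Q ⊆ T) :
    ∃ C : ℝ, 0 ≤ C ∧ ∀ Q ∈ 𝒱, ∀ F : Fin K → E, (∀ k, inner ℝ (F k) e = 1) → (∀ k, ‖F k‖ ≤ B) →
      ∀ ε : ℝ, 0 ≤ ε →
      (∀ u v w, |tripleDiff Q (stationaryDist Q) f F u v w| ≤ ε * (‖u‖ * ‖v‖ * ‖w‖)) →
      ∃ τ ∈ T, ∀ s, ‖F s - f (τ s)‖ ≤ C * ε := by
  obtain ⟨d, hd, hde⟩ := exists_dual_family_sum_eq hK hf he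
  let box : Set (Matrix (Fin K) (Fin K) ℝ) :=
    Set.univ.pi fun _ => Set.univ.pi fun i => Set.Icc (-(B * ‖d i‖)) (B * ‖d i‖)
  have hbox : IsCompact box := isCompact_univ_pi fun _ => isCompact_univ_pi fun _ => isCompact_Icc
  -- Keeping `π` as a separate coordinate under the closed condition of stationarity avoids any
  -- appeal to continuity of `stationaryDist`.
  let S : Set (Matrix (Fin K) (Fin K) ℝ × (Fin K → ℝ) × Matrix (Fin K) (Fin K) ℝ) :=
    (𝒱 ×ˢ (stdSimplex ℝ (Fin K) ×ˢ box)) ∩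
      ({p | p.2.1 ᵥ* p.1 = p.2.1} ∩ {p | ∀ i, ∑ j, p.2.2 i j = 1})
  have hS : IsCompact S := by
    refine (h𝒱.prod ((isCompact_stdSimplex (𝕜 := ℝ) (Fin K)).prod hbox)).inter_right
      (IsClosed.inter ?_ ?_)
    · exact isClosed_eq (continuous_snd.fst.matrix_vecMul continuous_fst) continuous_snd.fst
    · simp only [Set.ofPred_forall]
      exact isClosed_iInter fun i => isClosed_eq
        (continuous_finsetSum _ fun j _ => continuous_snd.snd.matrix_elem i j) continuous_const
  have key : ∃ C : ℝ, 0 ≤ C ∧ ∀ p ∈ S, ∀ F : Fin K → E,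
      (∀ k i, inner ℝ (F k) (d i) = p.2.2 k i) → (∀ k, inner ℝ (F k) e = 1) →
      (∀ k, ‖F k‖ ≤ B) → ∀ ε : ℝ, 0 ≤ ε →
      (∀ u v w, |tripleDiff p.1 p.2.1 f F u v w| ≤ ε * (‖u‖ * ‖v‖ * ‖w‖)) →
      ∃ τ ∈ T, ∀ s, ‖F s - f (τ s)‖ ≤ C * ε := by
    refine hS.induction_on (p := fun S => ∃ C : ℝ, 0 ≤ C ∧ ∀ p ∈ S, ∀ F : Fin K → E,
      (∀ k i, inner ℝ (F k) (d i) = p.2.2 k i) → (∀ k, inner ℝ (F k) e = 1) →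
      (∀ k, ‖F k‖ ≤ B) → ∀ ε : ℝ, 0 ≤ ε →
      (∀ u v w, |tripleDiff p.1 p.2.1 f F u v w| ≤ ε * (‖u‖ * ‖v‖ * ‖w‖)) →
      ∃ τ ∈ T, ∀ s, ‖F s - f (τ s)‖ ≤ C * ε) ⟨0, le_rfl, by simp⟩ ?_ ?_ ?_
    · rintro s t hst ⟨C, hC, h⟩
      exact ⟨C, hC, fun p hp => h p (hst hp)⟩
    · rintro s t ⟨C, hC, hs⟩ ⟨C', hC', ht⟩
      refine ⟨max C C', hC.trans (le_max_left _ _), ?_⟩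
      rintro p (hp | hp) F h1 h2 h3 ε hε h
      · obtain ⟨τ, hτ, hle⟩ := hs p hp F h1 h2 h3 ε hε h
        exact ⟨τ, hτ, fun s => (hle s).trans (by gcongr; exact le_max_left _ _)⟩
      · obtain ⟨τ, hτ, hle⟩ := ht p hp F h1 h2 h3 ε hε h
        exact ⟨τ, hτ, fun s => (hle s).trans (by gcongr; exact le_max_right _ _)⟩
    -- The coordinate `π` is positive because it is stationary for the irreducible `Q`, whether or
    -- not it is the chosen `stationaryDist Q`.
    · rintro ⟨Q, π, U⟩ ⟨⟨hQ, hπ, -⟩, hst, hU1⟩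
      have hch := hchain Q hQ
      obtain ⟨C, hC, hev⟩ := eventually_norm_sub_perm_le hd he hT hB hch.det_ne_zero
        (fun i => (IsStationaryDist.pos ⟨hπ, hst⟩ hch.irreducible i).ne')
        (fun i => Matrix.sum_row_of_mem_rowStochastic hch.transition i) hU1 (hsymm Q hQ)
      exact ⟨_, mem_nhdsWithin_of_mem_nhds hev, C, hC, fun p hp => hp⟩
  obtain ⟨C, hC, h⟩ := key
  refine ⟨C, hC, fun Q hQ F hF hFB => h (Q, stationaryDist Q, Matrix.of fun k i =>
    inner ℝ (F k) (d i)) ⟨⟨hQ, (hchain Q hQ).stationary.1, ?_⟩, (hchain Q hQ).stationary.2, ?_⟩ F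
    (fun k i => rfl) hF hFB⟩
  -- Cauchy–Schwarz puts the coefficients in the box; below, row sums are one because the dual
  -- family sums to `e`.
  · intro k _ i _
    exact abs_le.1 ((abs_real_inner_le_norm _ _).trans (by gcongr; exact hFB k))
  · intro k
    simp [← inner_sum, hde, hF]

end

end HMM

/-! ### Third order tensors in L² and their pairings with pure tensors. -/

namespace HMM

noncomputable section

variable {α : Type*} [MeasurableSpace α] {μ : Measure α} {K : ℕ}

theorem abs_integral_mul_le_eLpNorm {f g : α → ℝ} (hf : MemLp f 2 μ) (hg : MemLp g 2 μ) :
    |∫ x, f x * g x ∂μ| ≤ (eLpNorm f 2 μ).toReal * (eLpNorm g 2 μ).toReal := by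
  have h := abs_real_inner_le_norm (hg.toLp g) (hf.toLp f)
  rw [Lp.norm_toLp, Lp.norm_toLp, L2.inner_def] at h
  rw [mul_comm (eLpNorm f 2 μ).toReal]
  refine le_of_eq_of_le (congrArg _ (integral_congr_ae ?_)) h
  filter_upwards [hf.coeFn_toLp, hg.coeFn_toLp] with x h1 h2
  simp [h1, h2]

theorem integral_mul_eq_inner (f g : Lp ℝ 2 μ) : ∫ x, f x * g x ∂μ = inner ℝ f g := by
  rw [L2.inner_def]
  exact integral_congr_ae (.of_forall fun x => by simp [mul_comm])

theorem memLp_two_mul_prod {β : Type*} [MeasurableSpace β] {ν : Measure β} [SFinite ν]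
    {f : α → ℝ} {g : β → ℝ} (hf : MemLp f 2 μ) (hg : MemLp g 2 ν) :
    MemLp (fun z : α × β => f z.1 * g z.2) 2 (μ.prod ν) := by
  refine (memLp_two_iff_integrable_sq
    (hf.aestronglyMeasurable.comp_fst.mul hg.aestronglyMeasurable.comp_snd)).2 ?_
  refine (hf.integrable_sq.mul_prod hg.integrable_sq).congr (.of_forall fun z => ?_)
  exact (mul_pow _ _ _).symm

variable [SFinite μ]

theorem memLp_two_mul_prod₃ {u v w : α → ℝ} (hu : MemLp u 2 μ) (hv : MemLp v 2 μ)
    (hw : MemLp w 2 μ) :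
    MemLp (fun y : α × α × α => u y.1 * v y.2.1 * w y.2.2) 2 (μ.prod (μ.prod μ)) := by
  simpa only [mul_assoc] using memLp_two_mul_prod hu (memLp_two_mul_prod hv hw)

theorem integral_mul_prod₃ (u v w : α → ℝ) :
    ∫ y : α × α × α, u y.1 * v y.2.1 * w y.2.2 ∂(μ.prod (μ.prod μ)) =
      (∫ x, u x ∂μ) * (∫ x, v x ∂μ) * ∫ x, w x ∂μ := by
  simp only [mul_assoc]
  rw [integral_prod_mul u (fun z : α × α => v z.1 * w z.2), integral_prod_mul]

/-- The squared norm is the integral of a product of functions of separate variables, which factors.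
-/
theorem eLpNorm_mul_prod₃ (u v w : Lp ℝ 2 μ) :
    (eLpNorm (fun y : α × α × α => u y.1 * v y.2.1 * w y.2.2) 2 (μ.prod (μ.prod μ))).toReal =
      ‖u‖ * ‖v‖ * ‖w‖ := by
  have hm := memLp_two_mul_prod₃ (Lp.memLp u) (Lp.memLp v) (Lp.memLp w)
  rw [← Lp.norm_toLp _ hm]
  refine (sq_eq_sq₀ (norm_nonneg _) (by positivity)).1 ?_
  rw [← real_inner_self_eq_norm_sq, ← integral_mul_eq_inner]
  have h1 : ∫ y, hm.toLp _ y * hm.toLp _ y ∂(μ.prod (μ.prod μ)) =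
      ∫ y : α × α × α, (u y.1 * u y.1) * (v y.2.1 * v y.2.1) * (w y.2.2 * w y.2.2)
        ∂(μ.prod (μ.prod μ)) := by
    refine integral_congr_ae ?_
    filter_upwards [hm.coeFn_toLp] with y hy
    rw [hy]
    ring
  rw [h1, integral_mul_prod₃ (fun x => u x * u x) (fun x => v x * v x) (fun x => w x * w x),
    integral_mul_eq_inner, integral_mul_eq_inner, integral_mul_eq_inner,
    real_inner_self_eq_norm_sq, real_inner_self_eq_norm_sq, real_inner_self_eq_norm_sq]
  ring

theorem memLp_tripleFun (Q : Matrix (Fin K) (Fin K) ℝ) (f : Fin K → Lp ℝ 2 μ) :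
    MemLp (tripleFun Q (fun k => (f k : α → ℝ))) 2 (μ.prod (μ.prod μ)) := by
  unfold tripleFun
  refine memLp_finsetSum _ fun i _ => memLp_finsetSum _ fun j _ => memLp_finsetSum _ fun l _ => ?_
  exact (memLp_two_mul_prod₃ (Lp.memLp (f i)) (Lp.memLp (f j)) (Lp.memLp (f l))).const_mul _

theorem integral_tripleFun_mul (Q : Matrix (Fin K) (Fin K) ℝ) (f : Fin K → Lp ℝ 2 μ)
    (u v w : Lp ℝ 2 μ) :
    ∫ y : α × α × α, tripleFun Q (fun k => (f k : α → ℝ)) y * (u y.1 * v y.2.1 * w y.2.2)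
        ∂(μ.prod (μ.prod μ)) =
      tripleForm Q (stationaryDist Q) (fun k => inner ℝ (f k) u) (fun k => inner ℝ (f k) v)
        (fun k => inner ℝ (f k) w) := by
  have hi : ∀ i j l, Integrable (fun y : α × α × α =>
      stationaryDist Q i * Q i j * Q j l * (f i y.1 * f j y.2.1 * f l y.2.2) *
        (u y.1 * v y.2.1 * w y.2.2)) (μ.prod (μ.prod μ)) := fun i j l =>
    ((memLp_two_mul_prod₃ (Lp.memLp (f i)) (Lp.memLp (f j)) (Lp.memLp (f l))).const_mul
      _).integrable_mul (memLp_two_mul_prod₃ (Lp.memLp u) (Lp.memLp v) (Lp.memLp w))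
  simp only [tripleFun, Finset.sum_mul, tripleForm]
  rw [integral_finsetSum _ fun i _ => integrable_finsetSum _ fun j _ =>
    integrable_finsetSum _ fun l _ => hi i j l]
  refine Finset.sum_congr rfl fun i _ => ?_
  rw [integral_finsetSum _ fun j _ => integrable_finsetSum _ fun l _ => hi i j l]
  refine Finset.sum_congr rfl fun j _ => ?_
  rw [integral_finsetSum _ fun l _ => hi i j l]
  refine Finset.sum_congr rfl fun l _ => ?_
  rw [← integral_mul_eq_inner, ← integral_mul_eq_inner, ← integral_mul_eq_inner,
    ← integral_mul_prod₃ (fun x => f i x * u x) (fun x => f j x * v x) (fun x => f l x * w x),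
    ← integral_const_mul]
  exact integral_congr_ae (.of_forall fun y => by ring)

/-- Cauchy–Schwarz on the triple product space, where the pure tensor has norm `‖u‖ * ‖v‖ * ‖w‖`.
This is the only link between the L² distance and the abstract estimates. -/
theorem abs_tripleDiff_le (Q : Matrix (Fin K) (Fin K) ℝ) (f F : Fin K → Lp ℝ 2 μ)
    (u v w : Lp ℝ 2 μ) :
    |tripleDiff Q (stationaryDist Q) f F u v w| ≤
      (eLpNorm (tripleFun Q (fun k => (F k : α → ℝ)) - tripleFun Q (fun k => (f k : α → ℝ))) 2
        (μ.prod (μ.prod μ))).toReal * (‖u‖ * ‖v‖ * ‖w‖) := by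
  have hm := memLp_two_mul_prod₃ (Lp.memLp u) (Lp.memLp v) (Lp.memLp w)
  rw [tripleDiff, ← integral_tripleFun_mul, ← integral_tripleFun_mul, ← eLpNorm_mul_prod₃]
  have hsub := integral_sub ((memLp_tripleFun Q F).integrable_mul hm)
    ((memLp_tripleFun Q f).integrable_mul hm)
  simp only [Pi.mul_apply, ← sub_mul] at hsub
  rw [← hsub]
  exact abs_integral_mul_le_eLpNorm ((memLp_tripleFun Q F).sub (memLp_tripleFun Q f)) hm

theorem permNorm_le {D : ℕ} {Y : Set (EuclideanSpace ℝ (Fin D))} {Q : Matrix (Fin K) (Fin K) ℝ}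
    {f h : Fin K → L2 Y} {τ : Equiv.Perm (Fin K)} (hτ : τ ∈ symmPerms Q) {r : ℝ} (hr : 0 ≤ r)
    (hle : ∀ k, ‖h k + f k - f (τ k)‖ ≤ r) : permNorm Q f h ≤ Real.sqrt K * r := by
  rw [permNorm, ← Real.sqrt_sq hr, ← Real.sqrt_mul (by positivity)]
  refine Real.sqrt_le_sqrt ((ciInf_le ⟨0, ?_⟩ (⟨τ, hτ⟩ : symmPerms Q)).trans ?_)
  · rintro _ ⟨σ, rfl⟩
    positivity
  · calc ∑ k, ‖h k + f k - f (τ k)‖ ^ 2 ≤ ∑ _k : Fin K, r ^ 2 :=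
          Finset.sum_le_sum fun k _ => pow_le_pow_left₀ (norm_nonneg _) (hle k) 2
      _ = K * r ^ 2 := by simp

end

end HMM

/-! ### The lower bound. -/

theorem theorem2
    (K D : ℕ) (hK : 0 < K) (hD : 0 < D)
    -- the observation space, a set of finite Lebesgue measure
    (Y : Set (EuclideanSpace ℝ (Fin D))) (hY : MeasurableSet Y) (hYfin : volume Y < ∞)
    -- the hidden chain
    (Qstar : Matrix (Fin K) (Fin K) ℝ) (pistar : Fin K → ℝ)
    (hchain : HMM.ChainAssumptions Qstar pistar)
    -- the emission densities, square integrable and linearly independent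
    (fstar : Fin K → HMM.L2 Y)
    (hf_nonneg : ∀ k, ∀ᵐ y ∂(volume.restrict Y), 0 ≤ fstar k y)
    (hf_int : ∀ k, ∫ y, fstar k y ∂(volume.restrict Y) = 1)
    (hf_indep : LinearIndependent ℝ fstar)
    (hHD : HMM.H Qstar (Matrix.gram ℝ fstar) ≠ 0)
    -- the set of perturbations
    (𝒦 : Set (Fin K → HMM.L2 Y)) (h𝒦_closed : IsClosed 𝒦) (h𝒦_bdd : Bornology.IsBounded 𝒦)
    (h𝒦_int : ∀ h ∈ 𝒦, ∀ i, ∫ y, h i y ∂(volume.restrict Y) = 0)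
    -- the compact neighbourhood of `Qstar` in the space of transition matrices
    (𝒱 : Set (Matrix (Fin K) (Fin K) ℝ)) (h𝒱_sub : 𝒱 ⊆ HMM.transitionMatrices K)
    (h𝒱_compact : IsCompact 𝒱) (h𝒱_nhds : 𝒱 ∈ 𝓝[HMM.transitionMatrices K] Qstar)
    (h𝒱_H : ∀ Q ∈ 𝒱, HMM.H Q (Matrix.gram ℝ fstar) ≠ 0)
    (h𝒱_chain : ∀ Q ∈ 𝒱, HMM.ChainAssumptions Q (HMM.stationaryDist Q))
    (h𝒱_symm : ∀ Q ∈ 𝒱, HMM.symmPerms Q ⊆ HMM.symmPerms Qstar) :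
    ∃ c : ℝ, 0 < c ∧ ∀ h ∈ 𝒦, ∀ Q ∈ 𝒱,
      c * HMM.permNorm Qstar fstar h ≤
        HMM.norm3 Y (HMM.g Q (fstar + h) - HMM.g Q fstar) := by
  have : IsFiniteMeasure (volume.restrict Y) := ⟨by simpa using hYfin⟩
  -- The constant 1 is square integrable because `Y` has finite measure; it plays the role of `e`,
  -- so pairing with it is integration.
  have hone : MemLp (fun _ : EuclideanSpace ℝ (Fin D) => (1 : ℝ)) 2 (volume.restrict Y) :=
    memLp_const 1
  have hinner : ∀ u : HMM.L2 Y,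
      inner ℝ u (hone.toLp _) = ∫ y, u y ∂(volume.restrict Y) := by
    intro u
    rw [← HMM.integral_mul_eq_inner]
    refine integral_congr_ae ?_
    filter_upwards [hone.coeFn_toLp] with y hy
    rw [hy, mul_one]
  have he : ∀ k, inner ℝ (fstar k) (hone.toLp _) = 1 := fun k => by rw [hinner, hf_int]
  obtain ⟨R, hR⟩ := h𝒦_bdd.exists_norm_le
  -- The radius `R` may be negative when `𝒦` is empty, hence `max R 0`.
  have hB : 0 ≤ ‖fstar‖ + max R 0 := by positivity
  obtain ⟨C, hC, key⟩ := HMM.exists_norm_sub_perm_le hK hf_indep he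
    (T := HMM.symmPerms Qstar) (fun i j => rfl) hB h𝒱_compact h𝒱_chain h𝒱_symm
  -- Adding 1 keeps the constant well defined and positive when `C = 0`.
  refine ⟨(Real.sqrt K * C + 1)⁻¹, by positivity, fun h hh Q hQ => ?_⟩
  set ε := HMM.norm3 Y (HMM.g Q (fstar + h) - HMM.g Q fstar) with hε
  have hε0 : 0 ≤ ε := ENNReal.toReal_nonneg
  have hFB : ∀ k, ‖(fstar + h) k‖ ≤ ‖fstar‖ + max R 0 := fun k =>
    (norm_le_pi_norm (fstar + h) k).trans <| (norm_add_le _ _).trans <| by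
      gcongr
      exact (hR h hh).trans (le_max_left _ _)
  obtain ⟨τ, hτ, hle⟩ := key Q hQ (fstar + h)
    (fun k => by rw [Pi.add_apply, inner_add_left, he, hinner, h𝒦_int h hh, add_zero])
    hFB ε hε0
    (HMM.abs_tripleDiff_le Q fstar (fstar + h))
  have hperm := HMM.permNorm_le (f := fstar) (h := h) hτ (r := C * ε) (by positivity) fun k => by
    have := hle k
    rwa [Pi.add_apply, add_comm (fstar k)] at this
  rw [inv_mul_le_iff₀ (by positivity)]
  calc _ ≤ Real.sqrt K * (C * ε) := hperm
    _ ≤ (Real.sqrt K * C + 1) * ε := by linarith [mul_assoc (Real.sqrt K) C ε]
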